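/- All rings and algebras are commutative with $1$. Let $R$ be a ring, $n\ge 0$ an integer, and let $A$ be an $R$-algebra of rank $n$, i.e. the unit ideal of $R$ is generated by the set of those $r\in R$ for which the localization $A_r$ is a free $R_r$-module of rank $n$. Write $A^{\otimes n}$ for the $n$-fold tensor power of $A$ over $R$, on which $S_n$ acts by permuting the tensor factors, and $(A^{\otimes n})^G$ for the $R$-subalgebra of invariants under a subgroup $G\subseteq S_n$. The Ferrand homomorphism $\Phi_{A/R}\colon (A^{\otimes n})^{S_n}\to R$ is the unique $R$-algebra homomorphism such that multiplication by $\alpha\in (A^{\otimes n})^{S_n}$ on $A^{\otimes n}$ induces multiplication by $\Phi_{A/R}(\alpha)$ on the quotient $\bigwedge^n_R A$; in particular $\Phi_{A/R}(a\otimes\cdots\otimes a)$ is the norm of $a\in A$. A $G$-closure datum for $A$ over $R$ is an $R$-algebra homomorphism $\phi\colon (A^{\otimes n})^G\to R$ that extends $\Phi_{A/R}$, and its closure algebra is $$A^{\otimes n}/\phi \;=\; A^{\otimes n}/\bigl(\alpha-\phi(\alpha):\alpha\in (A^{\otimes n})^G\bigr)\;\cong\; A^{\otimes n}\otimes_{(A^{\otimes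 n})^G}R .$$ **Proposition.** Let $\phi$ be a $G$-closure datum for $A$ over $R$, let $R'$ be any $R$-algebra, and put $A'=R'\otimes_R A$. Then: 1. $A'$ is an $R'$-algebra of rank $n$, and the canonical $R'$-algebra homomorphisms $R'\otimes_R A^{\otimes n}\to A'^{\otimes_{R'} n}$ and $R'\otimes_R (A^{\otimes n})^G\to (A'^{\otimes_{R'} n})^G$ are isomorphisms. 2. The composite $$\phi'\colon (A'^{\otimes_{R'} n})^G\cong R'\otimes_R (A^{\otimes n})^G\xrightarrow{\ \mathrm{id}_{R'}\otimes\phi\ } R'\otimes_R R\cong R'$$ is a $G$-closure datum for $A'$ over $R'$. 3. The canonical isomorphism $R'\otimes_R A^{\otimes n}\cong A'^{\otimes_{R'} n}$ descends to an isomorphism of $R'$-algebras $$R'\otimes_R (A^{\otimes n}/\phi)\;\cong\; A'^{\otimes_{R'} n}/\phi'.$$ -/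

import Mathlib

open scoped TensorProduct

noncomputable section

namespace GClosure

universe u v w

/-- An `R`-module `M` is locally free of rank `n` if the unit ideal of `R` is generated by the
`r : R` such that the localization `M_r` is free of rank `n` over `R_r`. -/
def IsLocallyFreeOfRank (R : Type u) [CommRing R] (M : Type v) [AddCommGroup M] [Module R M]
    (n : ℕ) : Prop :=
  Ideal.span {r : R | Nonempty (Module.Basis (Fin n) (Localization.Away r)
    (LocalizedModule (Submonoid.powers r) M))} = ⊤

section

variable (R : Type u) [CommRing R] (A : Type v) [CommRing A] [Algebra R A] (n : ℕ)

/-- The `n`-fold tensor power `A^{⊗n}` over `R`, a commutative `R`-algebra. -/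
abbrev TensorPow : Type (max u v) := ⨂[R] _ : Fin n, A

/-- The action of a permutation on `A^{⊗n}` by permuting the tensor factors, sending
`a₁ ⊗ ⋯ ⊗ aₙ` to the pure tensor whose `σ i`-th factor is `aᵢ`. -/
def permHom (σ : Equiv.Perm (Fin n)) : TensorPow R A n →ₐ[R] TensorPow R A n :=
  AlgHom.ofLinearMap (PiTensorProduct.reindex R (fun _ : Fin n => A) σ).toLinearMap
    (by
      rw [PiTensorProduct.one_def]
      erw [PiTensorProduct.reindex_tprod]
      rfl)
    (by
      have h : ∀ a : Fin n → A, PiTensorProduct.reindex R (fun _ : Fin n => A) σ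
          (PiTensorProduct.tprod R a) = PiTensorProduct.tprod R (fun i => a (σ.symm i)) :=
        fun a => PiTensorProduct.reindex_tprod σ a
      intro x y
      simp only [LinearEquiv.coe_coe]
      induction x using PiTensorProduct.induction_on with
      | smul_tprod r a =>
        induction y using PiTensorProduct.induction_on with
        | smul_tprod s b =>
          simp only [smul_mul_assoc, mul_smul_comm, PiTensorProduct.tprod_mul_tprod, map_smul, h]
          rfl
        | add y z hy hz => rw [mul_add, map_add, hy, hz, map_add, mul_add]
      | add x z hx hz => rw [add_mul, map_add, hx, hz, map_add, add_mul])

/-- The `R`-algebra `(A^{⊗n})^G` of tensors that are invariant under `G`. -/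
def fixedPow (G : Subgroup (Equiv.Perm (Fin n))) : Subalgebra R (TensorPow R A n) where
  carrier := {x | ∀ σ ∈ G, permHom R A n σ x = x}
  mul_mem' hx hy σ hσ := by rw [map_mul, hx σ hσ, hy σ hσ]
  add_mem' hx hy σ hσ := by rw [map_add, hx σ hσ, hy σ hσ]
  algebraMap_mem' r σ _ := (permHom R A n σ).commutes r

theorem fixedPow_antitone {G H : Subgroup (Equiv.Perm (Fin n))} (h : G ≤ H) :
    fixedPow R A n H ≤ fixedPow R A n G :=
  fun _ hx σ hσ => hx σ (h hσ)

/-- The canonical projection `A^{⊗n} → ⋀ⁿ A`, `a₁ ⊗ ⋯ ⊗ aₙ ↦ a₁ ∧ ⋯ ∧ aₙ`. -/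
def toExterior : TensorPow R A n →ₗ[R] ⋀[R]^n A :=
  PiTensorProduct.lift (exteriorPower.ιMulti R n (M := A)).toMultilinearMap

variable {R A n}

/-- `Φ : (A^{⊗n})^{Sₙ} → R` is the Ferrand homomorphism of the rank-`n` algebra `A`: symmetric
tensors act by multiplication on `⋀ⁿ A`, which is locally free of rank one, and `Φ α` is the scalar
by which `α` acts. In particular `Φ (a ⊗ ⋯ ⊗ a)` is the norm of `a`, that is, the scalar with
`(a a₁) ∧ ⋯ ∧ (a aₙ) = Φ (a ⊗ ⋯ ⊗ a) • (a₁ ∧ ⋯ ∧ aₙ)`. -/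
def IsFerrandHom (Φ : fixedPow R A n ⊤ →ₐ[R] R) : Prop :=
  ∀ (α : fixedPow R A n ⊤) (x : TensorPow R A n),
    toExterior R A n (α * x) = Φ α • toExterior R A n x

theorem tprod_const_mem_fixedPow (a : A) :
    PiTensorProduct.tprod R (fun _ : Fin n => a) ∈ fixedPow R A n ⊤ :=
  fun σ _ => PiTensorProduct.reindex_tprod σ _

/-- The Ferrand homomorphism sends `a ⊗ ⋯ ⊗ a` to the norm of `a`. -/
theorem IsFerrandHom.norm {Φ : fixedPow R A n ⊤ →ₐ[R] R} (hΦ : IsFerrandHom Φ) (a : A)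
    (v : Fin n → A) :
    exteriorPower.ιMulti R n (fun i => a * v i) =
      Φ ⟨PiTensorProduct.tprod R fun _ => a, tprod_const_mem_fixedPow a⟩ •
        exteriorPower.ιMulti R n v := by
  have h := hΦ ⟨PiTensorProduct.tprod R fun _ => a, tprod_const_mem_fixedPow a⟩
    (PiTensorProduct.tprod R v)
  rw [PiTensorProduct.tprod_mul_tprod] at h
  simp only [toExterior, PiTensorProduct.lift.tprod] at h
  exact h

/-- `φ : (A^{⊗n})^G → R` is a `G`-closure datum for the rank-`n` algebra `A` over `R`: it extends
the Ferrand homomorphism `(A^{⊗n})^{Sₙ} → R`. -/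
def IsClosureDatum {G : Subgroup (Equiv.Perm (Fin n))} (φ : fixedPow R A n G →ₐ[R] R) : Prop :=
  IsFerrandHom (φ.comp (Subalgebra.inclusion (fixedPow_antitone R A n (le_top : G ≤ ⊤))))

/-- The ideal of `A^{⊗n}` generated by the `α - φ α` for `α` in `(A^{⊗n})^G`. -/
def closureIdeal {G : Subgroup (Equiv.Perm (Fin n))} (φ : fixedPow R A n G →ₐ[R] R) :
    Ideal (TensorPow R A n) :=
  Ideal.span (Set.range fun α : fixedPow R A n G =>
    (α : TensorPow R A n) - algebraMap R (TensorPow R A n) (φ α))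

/-- The closure algebra `A^{⊗n} / (α - φ α : α ∈ (A^{⊗n})^G)`, that is, the tensor product
`A^{⊗n} ⊗ R` over `(A^{⊗n})^G` (see `closureAlgebraEquivTensor`). -/
abbrev ClosureAlgebra {G : Subgroup (Equiv.Perm (Fin n))} (φ : fixedPow R A n G →ₐ[R] R) :
    Type (max u v) :=
  TensorPow R A n ⧸ closureIdeal φ

end

section

variable (R : Type u) [CommRing R] (A : Type v) [CommRing A] [Algebra R A] (n : ℕ)
  (R' : Type w) [CommRing R'] [Algebra R R']

/-- The `R`-algebra homomorphism `A^{⊗n} → (R' ⊗ A)^{⊗n}` sending `a₁ ⊗ ⋯ ⊗ aₙ` to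
`(1 ⊗ a₁) ⊗ ⋯ ⊗ (1 ⊗ aₙ)`. -/
def tensorPowExtend : TensorPow R A n →ₐ[R] TensorPow R' (R' ⊗[R] A) n :=
  PiTensorProduct.liftAlgHom
    (((PiTensorProduct.tprod R' (s := fun _ : Fin n => R' ⊗[R] A)).restrictScalars
      R).compLinearMap fun _ => (Algebra.TensorProduct.includeRight : A →ₐ[R] R' ⊗[R] A).toLinearMap)
    (by
      simp only [MultilinearMap.compLinearMap_apply, Pi.one_apply, AlgHom.toLinearMap_apply,
        map_one, MultilinearMap.coe_restrictScalars]
      rfl)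
    (by
      intro x y
      simp only [MultilinearMap.compLinearMap_apply, Pi.mul_apply, AlgHom.toLinearMap_apply,
        map_mul, MultilinearMap.coe_restrictScalars, PiTensorProduct.tprod_mul_tprod]
      rfl)

/-- The canonical homomorphism `R' ⊗ A^{⊗n} → (R' ⊗ A)^{⊗n}` (an isomorphism), sending
`r ⊗ (a₁ ⊗ ⋯ ⊗ aₙ)` to `r • ((1 ⊗ a₁) ⊗ ⋯ ⊗ (1 ⊗ aₙ))`. -/
def tensorPowBaseChange : R' ⊗[R] TensorPow R A n →ₐ[R'] TensorPow R' (R' ⊗[R] A) n :=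
  Algebra.TensorProduct.lift (Algebra.ofId R' _) (tensorPowExtend R A n R')
    fun _ _ => Commute.all _ _

theorem tensorPowExtend_tprod (a : Fin n → A) :
    tensorPowExtend R A n R' (PiTensorProduct.tprod R a) =
      PiTensorProduct.tprod R' fun i => (1 : R') ⊗ₜ[R] a i := by
  simp [tensorPowExtend, PiTensorProduct.liftAlgHom]

theorem permHom_tprod (σ : Equiv.Perm (Fin n)) (a : Fin n → A) :
    permHom R A n σ (PiTensorProduct.tprod R a) =
      PiTensorProduct.tprod R fun i => a (σ.symm i) :=
  PiTensorProduct.reindex_tprod σ a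

theorem permHom_tensorPowExtend (σ : Equiv.Perm (Fin n)) (x : TensorPow R A n) :
    permHom R' (R' ⊗[R] A) n σ (tensorPowExtend R A n R' x) =
      tensorPowExtend R A n R' (permHom R A n σ x) := by
  induction x using PiTensorProduct.induction_on with
  | smul_tprod r a =>
    rw [map_smul (tensorPowExtend R A n R'), map_smul (permHom R A n σ),
      map_smul (tensorPowExtend R A n R'), permHom_tprod, tensorPowExtend_tprod,
      tensorPowExtend_tprod, ← algebraMap_smul R' r, ← algebraMap_smul R' r, map_smul,
      permHom_tprod]
  | add x y hx hy => simp only [map_add, hx, hy]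

theorem tensorPowBaseChange_tmul (r : R') (x : TensorPow R A n) :
    tensorPowBaseChange R A n R' (r ⊗ₜ[R] x) = r • tensorPowExtend R A n R' x := by
  simp [tensorPowBaseChange, Algebra.ofId_apply, Algebra.smul_def]

/-- The canonical homomorphism `R' ⊗ (A^{⊗n})^G → ((R' ⊗ A)^{⊗n})^G` induced by
`tensorPowBaseChange`. -/
def fixedPowBaseChange (G : Subgroup (Equiv.Perm (Fin n))) :
    R' ⊗[R] fixedPow R A n G →ₐ[R'] fixedPow R' (R' ⊗[R] A) n G :=
  ((tensorPowBaseChange R A n R').comp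
    (Algebra.TensorProduct.map (AlgHom.id R' R') (fixedPow R A n G).val)).codRestrict _ (by
      intro z σ hσ
      induction z with
      | zero => simp
      | add x y hx hy => simp only [map_add, hx, hy]
      | tmul r α =>
        simp only [AlgHom.comp_apply, Algebra.TensorProduct.map_tmul, AlgHom.id_apply,
          Subalgebra.val_apply, tensorPowBaseChange_tmul, map_smul, permHom_tensorPowExtend]
        rw [α.2 σ hσ])

variable {R A n}

/-- The base change of `φ : (A^{⊗n})^G → R` along `R → R'`: the composite
`((R' ⊗ A)^{⊗n})^G ≅ R' ⊗ (A^{⊗n})^G → R' ⊗ R ≅ R'`, where the first map is the inverse of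
`fixedPowBaseChange` and the second one is `id ⊗ φ`. -/
def baseChangeDatum {G : Subgroup (Equiv.Perm (Fin n))} (φ : fixedPow R A n G →ₐ[R] R)
    (hb : Function.Bijective (fixedPowBaseChange R A n R' G)) :
    fixedPow R' (R' ⊗[R] A) n G →ₐ[R'] R' :=
  ((Algebra.TensorProduct.rid R R' R').toAlgHom.comp
    (Algebra.TensorProduct.map (AlgHom.id R' R') φ)).comp
      (AlgEquiv.ofBijective (fixedPowBaseChange R A n R' G) hb).symm.toAlgHom

end

section

variable {R : Type u} [CommRing R] {A : Type v} [CommRing A] [Algebra R A] {n : ℕ}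

/-- The presentation of the closure algebra as the tensor product of `A^{⊗n}` and `R` over
`(A^{⊗n})^G`, where `(A^{⊗n})^G` acts on `R` through `φ`. -/
def closureAlgebraEquivTensor {G : Subgroup (Equiv.Perm (Fin n))}
    (φ : fixedPow R A n G →ₐ[R] R) :
    letI := φ.toRingHom.toAlgebra
    ClosureAlgebra φ ≃ₐ[R] TensorPow R A n ⊗[fixedPow R A n G] R := by
  letI := φ.toRingHom.toAlgebra
  haveI : IsScalarTower R (fixedPow R A n G) R := IsScalarTower.of_algebraMap_eq'
    (by ext r; exact (φ.commutes r).symm)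
  have hq : ∀ α : fixedPow R A n G, Ideal.Quotient.mk (closureIdeal φ) (α : TensorPow R A n) =
      Ideal.Quotient.mk (closureIdeal φ) (algebraMap R (TensorPow R A n) (φ α)) := fun α =>
    Ideal.Quotient.eq.mpr (Ideal.subset_span ⟨α, rfl⟩)
  have ht : ∀ α : fixedPow R A n G, (α : TensorPow R A n) ⊗ₜ[fixedPow R A n G] (1 : R) =
      (1 : TensorPow R A n) ⊗ₜ[fixedPow R A n G] φ α := by
    intro α
    have h1 : (α : TensorPow R A n) = α • (1 : TensorPow R A n) := (mul_one _).symm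
    have h2 : φ α = α • (1 : R) := (mul_one _).symm
    rw [h1, h2, TensorProduct.smul_tmul]
  have hr : ∀ r : R, algebraMap R (TensorPow R A n) r ⊗ₜ[fixedPow R A n G] (1 : R) =
      (1 : TensorPow R A n) ⊗ₜ[fixedPow R A n G] r := by
    intro r
    have h := ht (algebraMap R _ r)
    rw [φ.commutes] at h
    exact h
  let f : ClosureAlgebra φ →ₐ[R] TensorPow R A n ⊗[fixedPow R A n G] R :=
    Ideal.Quotient.liftₐ (closureIdeal φ) Algebra.TensorProduct.includeLeft (by
      intro a ha
      have hle : closureIdeal φ ≤ RingHom.ker (Algebra.TensorProduct.includeLeft :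
          TensorPow R A n →ₐ[R] TensorPow R A n ⊗[fixedPow R A n G] R) := by
        refine Ideal.span_le.mpr ?_
        rintro _ ⟨α, rfl⟩
        rw [SetLike.mem_coe, RingHom.mem_ker, map_sub, sub_eq_zero]
        exact (ht α).trans (hr (φ α)).symm
      exact hle ha)
  have hf : ∀ x : TensorPow R A n,
      f (Ideal.Quotient.mk (closureIdeal φ) x) = x ⊗ₜ[fixedPow R A n G] (1 : R) := fun _ => rfl
  let g : TensorPow R A n ⊗[fixedPow R A n G] R →ₐ[fixedPow R A n G] ClosureAlgebra φ :=
    Algebra.TensorProduct.lift (R := fixedPow R A n G) (S := fixedPow R A n G)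
      ((Algebra.ofId (TensorPow R A n) (ClosureAlgebra φ)).restrictScalars _)
      { toRingHom := algebraMap R (ClosureAlgebra φ), commutes' := fun α => (hq α).symm }
      fun _ _ => Commute.all _ _
  have hg : ∀ x : TensorPow R A n, g (x ⊗ₜ[fixedPow R A n G] (1 : R)) =
      Ideal.Quotient.mk (closureIdeal φ) x := by
    intro x
    change Ideal.Quotient.mk (closureIdeal φ) x * algebraMap R (ClosureAlgebra φ) 1 = _
    rw [map_one, mul_one]
  clear_value f g
  refine AlgEquiv.ofBijective f ⟨?_, ?_⟩
  · intro y z h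
    obtain ⟨y, rfl⟩ := Ideal.Quotient.mk_surjective y
    obtain ⟨z, rfl⟩ := Ideal.Quotient.mk_surjective z
    rw [hf, hf] at h
    rw [← hg, ← hg, h]
  · intro z
    induction z with
    | zero => exact ⟨0, map_zero f⟩
    | add x y hx hy =>
      obtain ⟨a, rfl⟩ := hx
      obtain ⟨b, rfl⟩ := hy
      exact ⟨a + b, map_add f a b⟩
    | tmul x r =>
      refine ⟨Ideal.Quotient.mk _ (x * algebraMap R (TensorPow R A n) r), ?_⟩
      have h : (x * algebraMap R (TensorPow R A n) r) ⊗ₜ[fixedPow R A n G] (1 : R) =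
          (x ⊗ₜ[fixedPow R A n G] (1 : R)) *
            (algebraMap R (TensorPow R A n) r ⊗ₜ[fixedPow R A n G] (1 : R)) := by
        rw [Algebra.TensorProduct.tmul_mul_tmul, mul_one]
      rw [hf, h, hr, Algebra.TensorProduct.tmul_mul_tmul, mul_one, one_mul]

end

end GClosure

end

/-!
Let `M = A^{⊗n}`. Base change of the tensor power itself holds for every algebra: `A^{⊗n}` is the
coproduct of `n` copies of `A`, so the inverse of `tensorPowBaseChange` is given by the base
changes of the coprojections (`tensorPowBaseChange_bijective`).

The essential point is that the formation of `M^G` commutes with arbitrary base change. Suppose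
that there are `R`-linear endomorphisms `p` and `u σ` of `M` with `id = p + ∑ σ, u σ ∘ (σ - id)`
and the image of `p` contained in `M^G`. Then `p` restricts to the identity on `M^G`, so that
`R' ⊗ M^G → R' ⊗ M` is injective, and the base change of `p` fixes each invariant of `R' ⊗ M`, so
that each of them comes from `R' ⊗ M^G`. The scalars `c` for which `c • id` has such a
decomposition (`SplitsInvariants`) form an ideal, so the existence of the decomposition is a local
question on `R`.

If `A` has a basis, then `G` permutes a basis of `M`, and a choice of orbit representatives gives
the decomposition explicitly (`SplitsInvariants.one_of_basis`). In general `A` is finitely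
presented, and whenever `A_r` is free of rank `n` there are linear maps `A → Rⁿ → A` and
`Rⁿ → A → Rⁿ` with both composites equal to a power of `r` (`exists_comp_eq_smul_id_of_basis`).
Their tensor powers are equivariant and transport the decomposition from `Rⁿ` to `A` up to a power
of `r`. The same maps show that `R' ⊗ A` is again locally free of rank `n`.

The remaining claims are checked on generators: the Ferrand property after base change follows
from the one over `R` through the map `⋀ⁿ A → ⋀ⁿ (R' ⊗ A)`, and the ideal of the base-changed
datum is the extension of the ideal of `φ`, because both are generated by the images of the
`α - φ α`.
-/

/-! ### Modules that are free after localization -/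

/-- An isomorphism between localizations of finitely presented modules is realized, up to a
denominator `s`, by maps in both directions between the modules themselves. -/
theorem exists_comp_eq_smul_id_of_localized_equiv {R M N : Type*} [CommRing R]
    [AddCommGroup M] [Module R M] [AddCommGroup N] [Module R N] (S : Submonoid R)
    [Module.FinitePresentation R M] [Module.FinitePresentation R N]
    (e : LocalizedModule S M ≃ₗ[R] LocalizedModule S N) :
    ∃ (f : M →ₗ[R] N) (g : N →ₗ[R] M) (s : S),
      g ∘ₗ f = (s : R) • LinearMap.id ∧ f ∘ₗ g = (s : R) • LinearMap.id := by
  obtain ⟨f, s₁, hf⟩ := Module.FinitePresentation.exists_lift_of_isLocalizedModule S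
    (LocalizedModule.mkLinearMap S N) (e.toLinearMap ∘ₗ LocalizedModule.mkLinearMap S M)
  obtain ⟨g, s₂, hg⟩ := Module.FinitePresentation.exists_lift_of_isLocalizedModule S
    (LocalizedModule.mkLinearMap S M) (e.symm.toLinearMap ∘ₗ LocalizedModule.mkLinearMap S N)
  have hf' : ∀ x, LocalizedModule.mkLinearMap S N (f x) =
      (s₁ : R) • e (LocalizedModule.mkLinearMap S M x) := fun x => LinearMap.congr_fun hf x
  have hg' : ∀ x, LocalizedModule.mkLinearMap S M (g x) =
      (s₂ : R) • e.symm (LocalizedModule.mkLinearMap S N x) := fun x => LinearMap.congr_fun hg x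
  have h₁ : LocalizedModule.mkLinearMap S M ∘ₗ g ∘ₗ f =
      LocalizedModule.mkLinearMap S M ∘ₗ (((s₂ * s₁ : S) : R) • LinearMap.id) := by
    ext x
    simp only [LinearMap.comp_apply, hg', hf', map_smul, e.symm_apply_apply, LinearMap.smul_apply,
      LinearMap.id_apply, Submonoid.coe_mul, mul_smul]
  have h₂ : LocalizedModule.mkLinearMap S N ∘ₗ f ∘ₗ g =
      LocalizedModule.mkLinearMap S N ∘ₗ (((s₂ * s₁ : S) : R) • LinearMap.id) := by
    ext x
    simp only [LinearMap.comp_apply, hg', hf', map_smul, e.apply_symm_apply, LinearMap.smul_apply,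
      LinearMap.id_apply, Submonoid.coe_mul, mul_comm (s₂ : R), mul_smul]
  -- The composites agree with `s₂ * s₁` only after localization; finiteness of `M` and `N` gives
  -- multipliers `s₃` and `s₄` that make the identities hold before localization.
  obtain ⟨s₃, h₃⟩ := Module.Finite.exists_smul_of_comp_eq_of_isLocalizedModule S _ _ _ h₁
  obtain ⟨s₄, h₄⟩ := Module.Finite.exists_smul_of_comp_eq_of_isLocalizedModule S _ _ _ h₂
  have h₃' : ∀ x, (s₃ : R) • g (f x) = (s₃ : R) • (s₂ * s₁ : R) • x :=
    fun x => LinearMap.congr_fun h₃ x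
  have h₄' : ∀ x, (s₄ : R) • f (g x) = (s₄ : R) • (s₂ * s₁ : R) • x :=
    fun x => LinearMap.congr_fun h₄ x
  refine ⟨((s₃ * s₄ : S) : R) • f, g, s₃ * s₄ * (s₂ * s₁), ?_, ?_⟩ <;> ext x
  · simp only [LinearMap.comp_apply, LinearMap.smul_apply, map_smul, Submonoid.coe_mul,
      LinearMap.id_apply, mul_comm (s₃ : R), mul_smul, h₃']
  · simp only [LinearMap.comp_apply, LinearMap.smul_apply, Submonoid.coe_mul,
      LinearMap.id_apply, mul_smul, h₄']

theorem LocalizedModule.map_smul_id {R M : Type*} [CommRing R] [AddCommGroup M] [Module R M]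
    (S : Submonoid R) (s : R) :
    LocalizedModule.map S (s • LinearMap.id : M →ₗ[R] M) =
      algebraMap R (Localization S) s • LinearMap.id := by
  ext x
  induction x using LocalizedModule.induction_on with
  | h x t =>
    rw [LocalizedModule.map_mk]
    simp only [LinearMap.smul_apply, LinearMap.id_apply, algebraMap_smul, LocalizedModule.smul'_mk]

theorem LocalizedModule.map_comp {R M N P : Type*} [CommRing R] [AddCommGroup M] [Module R M]
    [AddCommGroup N] [Module R N] [AddCommGroup P] [Module R P] (S : Submonoid R)
    (g : N →ₗ[R] P) (f : M →ₗ[R] N) :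
    LocalizedModule.map S (g ∘ₗ f) = LocalizedModule.map S g ∘ₗ LocalizedModule.map S f := by
  ext x
  induction x using LocalizedModule.induction_on with
  | h x t => simp only [LinearMap.comp_apply, LocalizedModule.map_mk]

/-- The composites become invertible after localization, so the localization of `f` is an isomorphism
onto a free module. -/
theorem nonempty_basis_localizedModule_of_comp_eq_smul_id {R M : Type*} [CommRing R]
    [AddCommGroup M] [Module R M] {n : ℕ} {S : Submonoid R} {s : R} (hs : s ∈ S)
    {f : M →ₗ[R] (Fin n → R)} {g : (Fin n → R) →ₗ[R] M}
    (hgf : g ∘ₗ f = s • LinearMap.id) (hfg : f ∘ₗ g = s • LinearMap.id) :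
    Nonempty (Module.Basis (Fin n) (Localization S) (LocalizedModule S M)) := by
  obtain ⟨u, hu⟩ := IsLocalization.map_units (Localization S) (⟨s, hs⟩ : S)
  have h₁ : LocalizedModule.map S g ∘ₗ LocalizedModule.map S f = (u : Localization S) • .id := by
    rw [← LocalizedModule.map_comp, hgf, LocalizedModule.map_smul_id, hu]
  have h₂ : LocalizedModule.map S f ∘ₗ LocalizedModule.map S g = (u : Localization S) • .id := by
    rw [← LocalizedModule.map_comp, hfg, LocalizedModule.map_smul_id, hu]
  let e : LocalizedModule S M ≃ₗ[Localization S] LocalizedModule S (Fin n → R) :=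
    LinearEquiv.ofLinearMap (LocalizedModule.map S f)
      ((↑u⁻¹ : Localization S) • LocalizedModule.map S g)
      (by rw [LinearMap.comp_smul, h₂, smul_smul, Units.inv_mul, one_smul])
      (by rw [LinearMap.smul_comp, h₁, smul_smul, Units.inv_mul, one_smul])
  exact ⟨((Pi.basisFun R (Fin n)).ofIsLocalizedModule (Localization S) S
    (LocalizedModule.mkLinearMap S _)).map e.symm⟩

theorem exists_comp_eq_smul_id_of_basis {R M : Type*} [CommRing R]
    [AddCommGroup M] [Module R M] [Module.FinitePresentation R M] {n : ℕ} (S : Submonoid R)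
    (b : Module.Basis (Fin n) (Localization S) (LocalizedModule S M)) :
    ∃ (f : M →ₗ[R] (Fin n → R)) (g : (Fin n → R) →ₗ[R] M) (s : S),
      g ∘ₗ f = (s : R) • LinearMap.id ∧ f ∘ₗ g = (s : R) • LinearMap.id :=
  haveI : Module.FinitePresentation R (Fin n → R) := Module.finitePresentation_of_projective _ _
  exists_comp_eq_smul_id_of_localized_equiv S
    ((b.equiv ((Pi.basisFun R (Fin n)).ofIsLocalizedModule (Localization S) S
      (LocalizedModule.mkLinearMap S _)) (Equiv.refl _)).restrictScalars R)

/-! ### Invariants of a finite family of endomorphisms -/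

/-- A scalar `c` splits the invariants of a finite family `ρ` of endomorphisms of `M` if
`c • id = p + ∑ i, u i ∘ (ρ i - id)` for endomorphisms `p` and `u i` of `M` such that the image of
`p` consists of invariants. This is an identity between linear maps, so it survives base change. -/
def SplitsInvariants {R M ι : Type*} [CommRing R] [AddCommGroup M] [Module R M] [Fintype ι]
    (ρ : ι → M →ₗ[R] M) (c : R) : Prop :=
  ∃ (p : M →ₗ[R] M) (u : ι → M →ₗ[R] M),
    (∀ i, ρ i ∘ₗ p = p) ∧ c • LinearMap.id = p + ∑ i, u i ∘ₗ (ρ i - LinearMap.id)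

namespace SplitsInvariants

section

variable {R M N ι : Type*} [CommRing R] [AddCommGroup M] [Module R M] [AddCommGroup N]
  [Module R N] [Fintype ι] {ρ : ι → M →ₗ[R] M}

theorem zero : SplitsInvariants ρ 0 :=
  ⟨0, 0, fun _ => LinearMap.comp_zero _, by simp⟩

theorem add {c d : R} (hc : SplitsInvariants ρ c) (hd : SplitsInvariants ρ d) :
    SplitsInvariants ρ (c + d) := by
  obtain ⟨p, u, hp, hu⟩ := hc
  obtain ⟨q, v, hq, hv⟩ := hd
  refine ⟨p + q, u + v, fun i => by rw [LinearMap.comp_add, hp, hq], ?_⟩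
  rw [add_smul, hu, hv]
  simp only [Pi.add_apply, LinearMap.add_comp, Finset.sum_add_distrib]
  abel

theorem smul (a : R) {c : R} (hc : SplitsInvariants ρ c) : SplitsInvariants ρ (a • c) := by
  obtain ⟨p, u, hp, hu⟩ := hc
  refine ⟨a • p, a • u, fun i => by rw [LinearMap.comp_smul, hp], ?_⟩
  rw [smul_assoc, hu, smul_add, Finset.smul_sum]
  rfl

/-- The scalars that split the invariants form an ideal, so it is enough to find enough of them
locally. -/
theorem one_of_span_eq_top {t : Set R} (ht : Ideal.span t = ⊤)
    (h : ∀ r ∈ t, ∃ k : ℕ, SplitsInvariants ρ (r ^ k)) : SplitsInvariants ρ 1 := by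
  -- Each `r` in `t` lies in the radical of the ideal of splitting scalars.
  let I : Ideal R :=
    { carrier := {c | SplitsInvariants ρ c}
      add_mem' := add
      zero_mem' := zero
      smul_mem' := fun a _ => smul a }
  have hI : I.radical = ⊤ := top_le_iff.mp (ht ▸ Ideal.span_le.mpr h)
  exact (Ideal.eq_top_iff_one I).mp (Ideal.radical_eq_top.mp hI)

/-- Conjugation by equivariant maps `f` and `g` with `g ∘ f = s • id` turns a splitting of the unit
on `N` into a splitting of `s` on `M`. -/
theorem of_comp_eq_smul_id {ρ' : ι → N →ₗ[R] N} {s : R} {f : M →ₗ[R] N} {g : N →ₗ[R] M}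
    (hf : ∀ i, f ∘ₗ ρ i = ρ' i ∘ₗ f) (hg : ∀ i, g ∘ₗ ρ' i = ρ i ∘ₗ g)
    (hgf : g ∘ₗ f = s • LinearMap.id) (h : SplitsInvariants ρ' 1) : SplitsInvariants ρ s := by
  obtain ⟨p, u, hp, hu⟩ := h
  refine ⟨g ∘ₗ p ∘ₗ f, fun i => g ∘ₗ u i ∘ₗ f, fun i => ?_, ?_⟩
  · rw [← LinearMap.comp_assoc, ← hg, LinearMap.comp_assoc, ← LinearMap.comp_assoc f, hp]
  · have h₁ : ∀ i, (g ∘ₗ u i ∘ₗ f) ∘ₗ (ρ i - LinearMap.id) =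
        g ∘ₗ (u i ∘ₗ (ρ' i - LinearMap.id)) ∘ₗ f := fun i => by
      simp only [LinearMap.comp_assoc, LinearMap.comp_sub, LinearMap.sub_comp, hf,
        LinearMap.comp_id]
    have h₂ := congr_arg (fun v => g ∘ₗ v ∘ₗ f) hu
    simp only [one_smul, LinearMap.id_comp, hgf, LinearMap.add_comp, LinearMap.comp_add] at h₂
    rw [h₂]
    congr 1
    ext x
    simp only [h₁, LinearMap.comp_apply, LinearMap.sum_apply, map_sum]

/-- If the unit splits the invariants, the invariants `K` of `M` inject into `R' ⊗ M` after base
change, since `K` is a direct summand of `M`. -/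
theorem lTensor_subtype_injective (h : SplitsInvariants ρ 1) {K : Submodule R M}
    (hK : ∀ x, x ∈ K ↔ ∀ i, ρ i x = x) (R' : Type*) [AddCommGroup R'] [Module R R'] :
    Function.Injective (K.subtype.lTensor R') := by
  obtain ⟨p, u, hp, hu⟩ := h
  let q : M →ₗ[R] K := p.codRestrict K fun x => (hK _).mpr fun i => LinearMap.congr_fun (hp i) x
  have hq : q ∘ₗ K.subtype = LinearMap.id := by
    ext x
    have hx := LinearMap.congr_fun hu x
    simp only [one_smul, LinearMap.id_apply, LinearMap.add_apply, LinearMap.sum_apply,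
      LinearMap.comp_apply, LinearMap.sub_apply, (hK x).mp x.2, sub_self, map_zero,
      Finset.sum_const_zero, add_zero] at hx
    exact hx.symm
  refine Function.LeftInverse.injective (g := q.lTensor R') fun z => ?_
  rw [← LinearMap.comp_apply, ← LinearMap.lTensor_comp, hq, LinearMap.lTensor_id,
    LinearMap.id_apply]

/-- If the unit splits the invariants, every invariant of `R' ⊗ M` comes from the invariants `K`
of `M`: on an invariant the terms `u i ∘ (ρ i - id)` vanish, so the base change of `p` fixes it. -/
theorem mem_range_lTensor_subtype (h : SplitsInvariants ρ 1) {K : Submodule R M}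
    (hK : ∀ x, x ∈ K ↔ ∀ i, ρ i x = x) {R' : Type*} [AddCommGroup R'] [Module R R']
    {z : R' ⊗[R] M} (hz : ∀ i, (ρ i).lTensor R' z = z) :
    z ∈ LinearMap.range (K.subtype.lTensor R') := by
  obtain ⟨p, u, hp, hu⟩ := h
  let q : M →ₗ[R] K := p.codRestrict K fun x => (hK _).mpr fun i => LinearMap.congr_fun (hp i) x
  have hq : K.subtype ∘ₗ q = p := rfl
  have h₁ := LinearMap.congr_fun (congr_arg (LinearMap.lTensor R') hu) z
  have h₂ : ∀ i, (u i ∘ₗ (ρ i - LinearMap.id)).lTensor R' z = 0 := fun i => by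
    rw [LinearMap.lTensor_comp, LinearMap.comp_apply, LinearMap.lTensor_sub, LinearMap.sub_apply,
      hz, LinearMap.lTensor_id, LinearMap.id_apply, sub_self, map_zero]
  have h₃ : (∑ i, u i ∘ₗ (ρ i - LinearMap.id)).lTensor R' z = 0 := by
    rw [← LinearMap.coe_lTensorHom, map_sum, LinearMap.sum_apply]
    exact Finset.sum_eq_zero fun i _ => h₂ i
  rw [one_smul, LinearMap.lTensor_id, LinearMap.id_apply, LinearMap.lTensor_add,
    LinearMap.add_apply, h₃, add_zero, ← hq, LinearMap.lTensor_comp] at h₁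
  exact ⟨q.lTensor R' z, h₁.symm⟩

end

/-- The projection attached to a permutation module. With a representative `k₀` chosen in each
orbit, and `w l` carrying the representative of the orbit of `l` to `l`, the projection `p` sends
`b k₀` to the orbit sum and the other basis vectors to `0`, and `u g` is minus the projection to the
span of the `b l` with `w l = g`. -/
theorem one_of_basis {R M Γ κ : Type*} [CommRing R] [AddCommGroup M] [Module R M] [Group Γ]
    [Fintype Γ] [MulAction Γ κ] [Finite κ] (b : Module.Basis κ R M) {ρ : Γ → M →ₗ[R] M}
    (hρ : ∀ g k, ρ g (b k) = b (g • k)) : SplitsInvariants ρ 1 := by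
  classical
  have := Fintype.ofFinite κ
  let rep : κ → κ := fun k => (Quotient.mk (MulAction.orbitRel Γ κ) k).out
  have hrep_smul : ∀ (g : Γ) k, rep (g • k) = rep k := fun g k =>
    congr_arg Quotient.out (Quotient.sound (s := MulAction.orbitRel Γ κ) ⟨g, rfl⟩)
  have hrep : ∀ k, ∃ g : Γ, g • rep k = k := fun k =>
    (MulAction.orbitRel Γ κ).symm (Quotient.mk_out (s := MulAction.orbitRel Γ κ) k)
  choose w hw using hrep
  -- The filtered sum is empty unless `k` is the chosen representative of its orbit.
  refine ⟨b.constr R fun k => ∑ l with rep l = k, b l,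
    fun g => b.constr R fun k => if w k = g then - b k else 0, fun g => b.ext fun k => ?_,
    b.ext fun k => ?_⟩
  · rw [LinearMap.comp_apply, Module.Basis.constr_basis, map_sum]
    simp only [hρ]
    exact Finset.sum_bijective (g • ·) (MulAction.bijective g) (by simp [hrep_smul])
      fun _ _ => rfl
  -- The `g` with `w (g • k) = g` are the `w l` for `l` in the orbit of `k`, provided that `k` is a
  -- representative; otherwise there are none.
  · have horbit : ∑ l with rep l = k, b l = ∑ g : Γ with w (g • k) = g, b (g • k) := by
      have hl : ∀ l, rep l = k → w l • k = l := fun l h => h ▸ hw l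
      have hg : ∀ g : Γ, w (g • k) = g → rep (g • k) = k := fun g h =>
        MulAction.injective g (by simpa only [h] using hw (g • k))
      refine Finset.sum_bij' (fun l _ => w l) (fun g _ => g • k) ?_ ?_ ?_ ?_ ?_ <;>
        simp +contextual [hl, hg]
    rw [Finset.sum_filter, Finset.sum_filter] at horbit
    simp only [LinearMap.add_apply, LinearMap.sum_apply, LinearMap.comp_apply,
      LinearMap.sub_apply, LinearMap.id_apply, hρ, map_sub, Module.Basis.constr_basis,
      Finset.sum_sub_distrib, one_smul, Finset.sum_filter, Finset.sum_ite_eq, Finset.mem_univ,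
      if_true, sub_neg_eq_add]
    rw [horbit, ← add_assoc, ← Finset.sum_add_distrib, Finset.sum_eq_zero, zero_add]
    intro g _
    split_ifs <;> simp

end SplitsInvariants

/-! ### Locally free modules of rank `n` and invariants of their tensor powers -/

namespace GClosure

theorem IsLocallyFreeOfRank.finitePresentation {R M : Type*} [CommRing R] [AddCommGroup M]
    [Module R M] {n : ℕ} (h : IsLocallyFreeOfRank R M n) : Module.FinitePresentation R M := by
  refine Module.FinitePresentation.of_localizationSpan _ h fun r => ?_
  obtain ⟨b⟩ := r.2
  have := Module.Finite.of_basis b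
  have := Module.Free.of_basis b
  exact Module.finitePresentation_of_projective _ _

/-- The maps between `M` and `Rⁿ` whose composites are powers of `r` can be tensored with `R'`, which
avoids comparing the localizations of `R' ⊗ M` and of `M`. -/
theorem IsLocallyFreeOfRank.baseChange {R M : Type*} [CommRing R] [AddCommGroup M]
    [Module R M] {n : ℕ} (h : IsLocallyFreeOfRank R M n) (R' : Type*) [CommRing R'] [Algebra R R'] :
    IsLocallyFreeOfRank R' (R' ⊗[R] M) n := by
  have := h.finitePresentation
  rw [IsLocallyFreeOfRank, ← top_le_iff, ← Ideal.map_top (algebraMap R R'), ← h, Ideal.map_span]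
  refine Ideal.span_mono ?_
  rintro _ ⟨r, ⟨b⟩, rfl⟩
  obtain ⟨f, g, ⟨_, k, rfl⟩, hgf, hfg⟩ := exists_comp_eq_smul_id_of_basis _ b
  let e : R' ⊗[R] (Fin n → R) ≃ₗ[R'] (Fin n → R') := TensorProduct.piScalarRight R R' R' (Fin n)
  have hgf' := congr_arg (LinearMap.baseChange R') hgf
  have hfg' := congr_arg (LinearMap.baseChange R') hfg
  rw [LinearMap.baseChange_comp, LinearMap.baseChange_smul, LinearMap.baseChange_id,
    ← algebraMap_smul R', map_pow] at hgf' hfg'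
  refine nonempty_basis_localizedModule_of_comp_eq_smul_id (s := algebraMap R R' r ^ k) ⟨k, rfl⟩
    (f := e.toLinearMap ∘ₗ f.baseChange R') (g := g.baseChange R' ∘ₗ e.symm.toLinearMap) ?_ ?_
  · rw [LinearMap.comp_assoc, ← LinearMap.comp_assoc _ e.toLinearMap, LinearEquiv.symm_comp,
      LinearMap.id_comp, hgf']
  · rw [LinearMap.comp_assoc, ← LinearMap.comp_assoc e.symm.toLinearMap, hfg',
      LinearMap.smul_comp, LinearMap.comp_smul, LinearMap.id_comp, LinearEquiv.comp_symm]

section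

variable {R A B : Type*} [CommRing R] [CommRing A] [Algebra R A] [CommRing B] [Algebra R B] {n : ℕ}

/-- Tensor powers of linear maps are equivariant; `f` need not be multiplicative. -/
theorem map_comp_permHom (f : A →ₗ[R] B) (σ : Equiv.Perm (Fin n)) :
    PiTensorProduct.map (fun _ : Fin n => f) ∘ₗ (permHom R A n σ).toLinearMap =
      (permHom R B n σ).toLinearMap ∘ₗ PiTensorProduct.map fun _ => f :=
  PiTensorProduct.map_comp_reindex_eq (fun _ => f) σ

theorem map_comp_map_eq_pow_smul_id {f : A →ₗ[R] B} {g : B →ₗ[R] A} {s : R}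
    (h : g ∘ₗ f = s • LinearMap.id) :
    PiTensorProduct.map (fun _ : Fin n => g) ∘ₗ PiTensorProduct.map (fun _ => f) =
      s ^ n • LinearMap.id := by
  rw [← PiTensorProduct.map_comp]
  ext a
  simp only [h, LinearMap.compMultilinearMap_apply, PiTensorProduct.map_tprod,
    LinearMap.smul_apply, LinearMap.id_apply]
  rw [MultilinearMap.map_smul_univ, Finset.prod_const, Finset.card_univ, Fintype.card_fin]

open Classical in
/-- A basis of `A` induces a basis of `A^{⊗n}` that is indexed by the maps `Fin n → Fin n` and
permuted by `G`. -/
theorem splitsInvariants_permHom_of_basis (b : Module.Basis (Fin n) R A)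
    (G : Subgroup (Equiv.Perm (Fin n))) :
    SplitsInvariants (fun σ : G => (permHom R A n σ).toLinearMap) 1 := by
  let : MulAction G (Fin n → Fin n) := arrowAction
  refine SplitsInvariants.one_of_basis (Basis.piTensorProduct fun _ : Fin n => b) fun σ k => ?_
  rw [Basis.piTensorProduct_apply, Basis.piTensorProduct_apply]
  exact permHom_tprod R A n σ _

open Classical in
/-- Locally free modules of rank `n` admit maps to and from `Rⁿ` whose composites are powers of the
given local parameters, which transports the splitting for `Rⁿ` to `A`. -/
theorem splitsInvariants_permHom (hA : IsLocallyFreeOfRank R A n)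
    (G : Subgroup (Equiv.Perm (Fin n))) :
    SplitsInvariants (fun σ : G => (permHom R A n σ).toLinearMap) 1 := by
  have : Module.FinitePresentation R A := hA.finitePresentation
  refine SplitsInvariants.one_of_span_eq_top hA ?_
  rintro r ⟨b⟩
  obtain ⟨f, g, ⟨_, k, rfl⟩, hgf, -⟩ := exists_comp_eq_smul_id_of_basis _ b
  refine ⟨k * n, ?_⟩
  rw [pow_mul]
  have h := map_comp_map_eq_pow_smul_id (n := n) hgf
  exact SplitsInvariants.of_comp_eq_smul_id (fun σ : G => map_comp_permHom f σ.1)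
    (fun σ : G => map_comp_permHom g σ.1) h
    (splitsInvariants_permHom_of_basis (Pi.basisFun R (Fin n)) G)

end

end GClosure

/-! ### Base change of tensor powers and exterior powers -/

namespace GClosure

section

variable (R A : Type*) [CommRing R] [CommRing A] [Algebra R A] (n : ℕ)
  (R' : Type*) [CommRing R'] [Algebra R R']

/-- The inverse of `tensorPowBaseChange`, sending `x₁ ⊗ ⋯ ⊗ xₙ` to the product of the images of the
`xᵢ` under the base changes `R' ⊗ A → R' ⊗ A^{⊗n}` of the coprojections `A → A^{⊗n}`. -/
noncomputable def tensorPowBaseChangeInv :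
    TensorPow R' (R' ⊗[R] A) n →ₐ[R'] R' ⊗[R] TensorPow R A n :=
  PiTensorProduct.liftAlgHom
    ((MultilinearMap.mkPiAlgebra R' (Fin n) (R' ⊗[R] TensorPow R A n)).compLinearMap fun i =>
      (Algebra.TensorProduct.map (AlgHom.id R' R')
        (PiTensorProduct.singleAlgHom (R := R) (A := fun _ : Fin n => A) i)).toLinearMap)
    (by
      simp only [MultilinearMap.compLinearMap_apply, MultilinearMap.mkPiAlgebra_apply,
        AlgHom.toLinearMap_apply, Pi.one_apply, map_one, Finset.prod_const_one])
    (by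
      intro x y
      simp only [MultilinearMap.compLinearMap_apply, MultilinearMap.mkPiAlgebra_apply,
        AlgHom.toLinearMap_apply, Pi.mul_apply, map_mul, Finset.prod_mul_distrib])

theorem tensorPowBaseChangeInv_single (i : Fin n) (x : R' ⊗[R] A) :
    tensorPowBaseChangeInv R A n R' (PiTensorProduct.singleAlgHom i x) =
      Algebra.TensorProduct.map (AlgHom.id R' R')
        (PiTensorProduct.singleAlgHom (R := R) (A := fun _ : Fin n => A) i) x := by
  have h : tensorPowBaseChangeInv R A n R' (PiTensorProduct.singleAlgHom i x) =
      ∏ j, Algebra.TensorProduct.map (AlgHom.id R' R')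
        (PiTensorProduct.singleAlgHom (R := R) (A := fun _ : Fin n => A) j)
          (MonoidHom.mulSingle (fun _ : Fin n => R' ⊗[R] A) i x j) :=
    PiTensorProduct.lift.tprod _
  rw [h, Finset.prod_eq_single i]
  · simp
  · intro j _ hj
    simp [Pi.mulSingle_eq_of_ne hj]
  · simp

theorem tensorPowExtend_single (i : Fin n) (a : A) :
    tensorPowExtend R A n R' (PiTensorProduct.singleAlgHom i a) =
      PiTensorProduct.singleAlgHom (R := R') (A := fun _ : Fin n => R' ⊗[R] A) i
        ((1 : R') ⊗ₜ[R] a) := by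
  refine (tensorPowExtend_tprod R A n R' _).trans ?_
  refine congr_arg (PiTensorProduct.tprod R') (funext fun j => ?_)
  obtain rfl | h := eq_or_ne j i
  · simp
  · simp [Pi.mulSingle_eq_of_ne h, Algebra.TensorProduct.one_def]

theorem tensorPowBaseChange_bijective : Function.Bijective (tensorPowBaseChange R A n R') := by
  have h₁ : (tensorPowBaseChangeInv R A n R').comp (tensorPowBaseChange R A n R') =
      AlgHom.id R' _ := by
    refine Algebra.TensorProduct.ext (by ext) ?_
    refine PiTensorProduct.algHom_ext fun i => AlgHom.ext fun a => ?_
    change tensorPowBaseChangeInv R A n R' (tensorPowBaseChange R A n R'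
      (1 ⊗ₜ PiTensorProduct.singleAlgHom i a)) = 1 ⊗ₜ PiTensorProduct.singleAlgHom i a
    rw [tensorPowBaseChange_tmul, one_smul, tensorPowExtend_single, tensorPowBaseChangeInv_single,
      Algebra.TensorProduct.map_tmul, map_one]
  have h₂ : (tensorPowBaseChange R A n R').comp (tensorPowBaseChangeInv R A n R') =
      AlgHom.id R' _ := by
    refine PiTensorProduct.algHom_ext fun i => Algebra.TensorProduct.ext (by ext)
      (AlgHom.ext fun a => ?_)
    change tensorPowBaseChange R A n R' (tensorPowBaseChangeInv R A n R'
      (PiTensorProduct.singleAlgHom i (1 ⊗ₜ a))) = PiTensorProduct.singleAlgHom i (1 ⊗ₜ a)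
    rw [tensorPowBaseChangeInv_single, Algebra.TensorProduct.map_tmul, map_one,
      tensorPowBaseChange_tmul, one_smul, tensorPowExtend_single]
  exact ⟨Function.LeftInverse.injective (DFunLike.congr_fun h₁),
    Function.RightInverse.surjective (DFunLike.congr_fun h₂)⟩

/-- The canonical `R`-linear map `⋀ⁿ A → ⋀ⁿ (R' ⊗ A)`, sending `a₁ ∧ ⋯ ∧ aₙ` to
`(1 ⊗ a₁) ∧ ⋯ ∧ (1 ⊗ aₙ)`. -/
noncomputable def exteriorExtend : ⋀[R]^n A →ₗ[R] ⋀[R']^n (R' ⊗[R] A) :=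
  exteriorPower.alternatingMapLinearEquiv
    { ((exteriorPower.ιMulti R' n (M := R' ⊗[R] A)).toMultilinearMap.restrictScalars
        R).compLinearMap fun _ => TensorProduct.mk R R' A 1 with
      map_eq_zero_of_eq' := fun _ _ _ h hij =>
        (exteriorPower.ιMulti R' n (M := R' ⊗[R] A)).map_eq_zero_of_eq _ (congr_arg _ h) hij }

theorem exteriorExtend_ιMulti (a : Fin n → A) :
    exteriorExtend R A n R' (exteriorPower.ιMulti R n a) =
      exteriorPower.ιMulti R' n fun i => (1 : R') ⊗ₜ[R] a i := by
  rw [exteriorExtend, exteriorPower.alternatingMapLinearEquiv_apply_ιMulti]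
  rfl

theorem toExterior_tensorPowExtend (x : TensorPow R A n) :
    toExterior R' (R' ⊗[R] A) n (tensorPowExtend R A n R' x) =
      exteriorExtend R A n R' (toExterior R A n x) := by
  induction x using PiTensorProduct.induction_on with
  | smul_tprod r a =>
    have h : toExterior R' (R' ⊗[R] A) n
        (PiTensorProduct.tprod R' fun i => (1 : R') ⊗ₜ[R] a i) =
        exteriorExtend R A n R' (toExterior R A n (PiTensorProduct.tprod R a)) := by
      rw [toExterior, toExterior, PiTensorProduct.lift.tprod, PiTensorProduct.lift.tprod]
      exact (exteriorExtend_ιMulti R A n R' a).symm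
    rw [map_smul (tensorPowExtend R A n R'), map_smul (toExterior R A n),
      map_smul (exteriorExtend R A n R'), tensorPowExtend_tprod, ← algebraMap_smul R' r,
      ← algebraMap_smul R' r, map_smul, h]
  | add x y hx hy =>
    rw [map_add (tensorPowExtend R A n R'), map_add (toExterior R A n), map_add, map_add, hx, hy]

end

end GClosure

/-! ### Base change of closure data -/

namespace GClosure

section

variable {R A : Type*} [CommRing R] [CommRing A] [Algebra R A] {n : ℕ}
  {R' : Type*} [CommRing R'] [Algebra R R'] {G : Subgroup (Equiv.Perm (Fin n))}

theorem coe_fixedPowBaseChange (z : R' ⊗[R] fixedPow R A n G) :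
    (fixedPowBaseChange R A n R' G z : TensorPow R' (R' ⊗[R] A) n) =
      tensorPowBaseChange R A n R' ((fixedPow R A n G).toSubmodule.subtype.lTensor R' z) :=
  rfl

theorem coe_fixedPowBaseChange_tmul (r : R') (α : fixedPow R A n G) :
    (fixedPowBaseChange R A n R' G (r ⊗ₜ α) : TensorPow R' (R' ⊗[R] A) n) =
      r • tensorPowExtend R A n R' α :=
  tensorPowBaseChange_tmul R A n R' r _

theorem permHom_tensorPowBaseChange (σ : Equiv.Perm (Fin n)) (z : R' ⊗[R] TensorPow R A n) :
    permHom R' (R' ⊗[R] A) n σ (tensorPowBaseChange R A n R' z) =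
      tensorPowBaseChange R A n R' ((permHom R A n σ).toLinearMap.lTensor R' z) := by
  induction z with
  | zero => simp only [map_zero]
  | add x y hx hy => simp only [map_add, hx, hy]
  | tmul r x =>
    rw [LinearMap.lTensor_tmul, tensorPowBaseChange_tmul, tensorPowBaseChange_tmul, map_smul,
      permHom_tensorPowExtend]
    rfl

theorem fixedPowBaseChange_bijective (hA : IsLocallyFreeOfRank R A n) (R' : Type*) [CommRing R']
    [Algebra R R'] (G : Subgroup (Equiv.Perm (Fin n))) :
    Function.Bijective (fixedPowBaseChange R A n R' G) := by
  classical
  have hs := splitsInvariants_permHom hA G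
  have hK : ∀ x, x ∈ (fixedPow R A n G).toSubmodule ↔
      ∀ σ : G, (permHom R A n σ).toLinearMap x = x :=
    fun x => ⟨fun h σ => h σ.1 σ.2, fun h σ hσ => h ⟨σ, hσ⟩⟩
  have hb := tensorPowBaseChange_bijective R A n R'
  constructor
  · refine Function.Injective.of_comp (f := Subtype.val) ?_
    exact hb.injective.comp (hs.lTensor_subtype_injective hK R')
  · rintro ⟨y, hy⟩
    obtain ⟨z, rfl⟩ := hb.surjective y
    obtain ⟨x, hx⟩ := hs.mem_range_lTensor_subtype hK (z := z) fun σ =>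
      hb.injective ((permHom_tensorPowBaseChange σ.1 z).symm.trans (hy σ.1 σ.2))
    exact ⟨x, Subtype.ext ((coe_fixedPowBaseChange x).trans (congr_arg _ hx))⟩

variable (φ : fixedPow R A n G →ₐ[R] R) (hb : Function.Bijective (fixedPowBaseChange R A n R' G))

theorem baseChangeDatum_fixedPowBaseChange_tmul (r : R') (α : fixedPow R A n G) :
    baseChangeDatum R' φ hb (fixedPowBaseChange R A n R' G (r ⊗ₜ α)) = φ α • r := by
  have h : (AlgEquiv.ofBijective (fixedPowBaseChange R A n R' G) hb).symm
      (fixedPowBaseChange R A n R' G (r ⊗ₜ α)) = r ⊗ₜ α :=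
    (AlgEquiv.ofBijective (fixedPowBaseChange R A n R' G) hb).symm_apply_apply (r ⊗ₜ α)
  change Algebra.TensorProduct.rid R R' R' (Algebra.TensorProduct.map (AlgHom.id R' R') φ
    ((AlgEquiv.ofBijective (fixedPowBaseChange R A n R' G) hb).symm
      (fixedPowBaseChange R A n R' G (r ⊗ₜ α)))) = _
  rw [h, Algebra.TensorProduct.map_tmul, AlgHom.id_apply, Algebra.TensorProduct.rid_tmul]

variable {φ} in
theorem IsClosureDatum.baseChange (hφ : IsClosureDatum φ)
    (ht : Function.Surjective (fixedPowBaseChange R A n R' ⊤)) :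
    IsClosureDatum (baseChangeDatum R' φ hb) := by
  intro α x
  obtain ⟨z, rfl⟩ := ht α
  obtain ⟨y, rfl⟩ := (tensorPowBaseChange_bijective R A n R').surjective x
  induction z with
  | zero => simp only [map_zero, ZeroMemClass.coe_zero, zero_mul, zero_smul]
  | add z w hz hw =>
    rw [map_add, Subalgebra.coe_add, add_mul, map_add, hz, hw, map_add, add_smul]
  | tmul r α =>
    induction y with
    | zero => simp only [map_zero, mul_zero, smul_zero]
    | add y z hy hz => rw [map_add, mul_add, map_add, hy, hz, map_add, smul_add]
    | tmul s x =>
      have hα : Subalgebra.inclusion (fixedPow_antitone R' (R' ⊗[R] A) n (le_top : G ≤ ⊤))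
          (fixedPowBaseChange R A n R' ⊤ (r ⊗ₜ α)) =
          fixedPowBaseChange R A n R' G
            (r ⊗ₜ Subalgebra.inclusion (fixedPow_antitone R A n le_top) α) := rfl
      rw [AlgHom.comp_apply, hα, baseChangeDatum_fixedPowBaseChange_tmul,
        coe_fixedPowBaseChange_tmul, tensorPowBaseChange_tmul, smul_mul_smul_comm, ← map_mul,
        map_smul, map_smul, toExterior_tensorPowExtend, toExterior_tensorPowExtend, hφ α x,
        map_smul (exteriorExtend R A n R'), AlgHom.comp_apply, smul_assoc, smul_smul, smul_comm]

/-- The ideal of the base-changed datum is the extension of the ideal of `φ`: its generators depend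
`R'`-linearly on an element of `R' ⊗ (A^{⊗n})^G`, so those given by `1 ⊗ α` suffice. -/
theorem map_closureIdeal_eq_closureIdeal_baseChangeDatum :
    ((closureIdeal φ).map (Algebra.TensorProduct.includeRight :
      TensorPow R A n →ₐ[R] R' ⊗[R] TensorPow R A n)).map (tensorPowBaseChange R A n R') =
      closureIdeal (baseChangeDatum R' φ hb) := by
  have hgen : ∀ α : fixedPow R A n G,
      tensorPowBaseChange R A n R' ((1 : R') ⊗ₜ[R]
        ((α : TensorPow R A n) - algebraMap R (TensorPow R A n) (φ α))) =
      (fixedPowBaseChange R A n R' G (1 ⊗ₜ α) : TensorPow R' (R' ⊗[R] A) n) -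
        algebraMap R' _ (baseChangeDatum R' φ hb (fixedPowBaseChange R A n R' G (1 ⊗ₜ α))) :=
    fun α => by
      rw [coe_fixedPowBaseChange_tmul, baseChangeDatum_fixedPowBaseChange_tmul,
        tensorPowBaseChange_tmul, map_sub, AlgHom.commutes, smul_sub, one_smul, one_smul,
        ← Algebra.algebraMap_eq_smul_one, ← IsScalarTower.algebraMap_apply]
  apply le_antisymm
  · rw [closureIdeal, Ideal.map_span, Ideal.map_span, Ideal.span_le]
    rintro _ ⟨_, ⟨_, ⟨α, rfl⟩, rfl⟩, rfl⟩
    exact Ideal.subset_span ⟨fixedPowBaseChange R A n R' G (1 ⊗ₜ α), (hgen α).symm⟩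
  · refine Ideal.span_le.mpr ?_
    rintro _ ⟨α, rfl⟩
    obtain ⟨z, rfl⟩ := hb.surjective α
    induction z with
    | zero => simp only [map_zero, ZeroMemClass.coe_zero, sub_zero, SetLike.mem_coe, zero_mem]
    | add z w hz hw =>
      have h := add_mem hz hw
      rw [sub_add_sub_comm, ← map_add, ← map_add, ← Subalgebra.coe_add, ← map_add] at h
      exact h
    | tmul r α =>
      have hr : (r ⊗ₜ[R] α : R' ⊗[R] fixedPow R A n G) = r • (1 ⊗ₜ α) := by
        rw [TensorProduct.smul_tmul', smul_eq_mul, mul_one]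
      rw [hr, map_smul]
      dsimp only
      rw [map_smul, Subalgebra.coe_smul, smul_eq_mul, map_mul, ← Algebra.smul_def,
        ← smul_sub, ← hgen, Algebra.smul_def]
      exact Ideal.mul_mem_left _ _ (Ideal.mem_map_of_mem _ (Ideal.mem_map_of_mem _
        (Ideal.subset_span ⟨α, rfl⟩)))

/-- The isomorphism `R' ⊗ (A^{⊗n} / φ) ≅ (R' ⊗ A)^{⊗n} / φ'` induced by `tensorPowBaseChange`, for
`φ'` the base change of `φ`. -/
noncomputable def closureAlgebraBaseChange :
    R' ⊗[R] ClosureAlgebra φ ≃ₐ[R'] ClosureAlgebra (baseChangeDatum R' φ hb) :=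
  (Algebra.TensorProduct.tensorQuotientEquiv R' (TensorPow R A n) R' (closureIdeal φ)).trans
    (Ideal.quotientEquivAlg _ _
      (AlgEquiv.ofBijective _ (tensorPowBaseChange_bijective R A n R'))
      (map_closureIdeal_eq_closureIdeal_baseChangeDatum φ hb).symm)

theorem closureAlgebraBaseChange_tmul_mk (r : R') (x : TensorPow R A n) :
    closureAlgebraBaseChange φ hb (r ⊗ₜ[R] Ideal.Quotient.mk (closureIdeal φ) x) =
      Ideal.Quotient.mk (closureIdeal (baseChangeDatum R' φ hb))
        (tensorPowBaseChange R A n R' (r ⊗ₜ[R] x)) :=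
  rfl

end

end GClosure

theorem mainTheorem8 {R : Type*} [CommRing R] {A : Type*} [CommRing A] [Algebra R A] (n : ℕ)
    (hA : GClosure.IsLocallyFreeOfRank R A n) (R' : Type*) [CommRing R'] [Algebra R R']
    (G : Subgroup (Equiv.Perm (Fin n))) (φ : GClosure.fixedPow R A n G →ₐ[R] R)
    (hφ : GClosure.IsClosureDatum φ) :
    GClosure.IsLocallyFreeOfRank R' (R' ⊗[R] A) n ∧
    Function.Bijective (GClosure.tensorPowBaseChange R A n R') ∧
    ∃ hb : Function.Bijective (GClosure.fixedPowBaseChange R A n R' G),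
      GClosure.IsClosureDatum (GClosure.baseChangeDatum R' φ hb) ∧
      ∃ e : R' ⊗[R] GClosure.ClosureAlgebra φ ≃ₐ[R']
          GClosure.ClosureAlgebra (GClosure.baseChangeDatum R' φ hb),
        ∀ (r : R') (x : GClosure.TensorPow R A n),
          e (r ⊗ₜ[R] Ideal.Quotient.mk (GClosure.closureIdeal φ) x) =
            Ideal.Quotient.mk (GClosure.closureIdeal (GClosure.baseChangeDatum R' φ hb))
              (GClosure.tensorPowBaseChange R A n R' (r ⊗ₜ[R] x)) := by
  have hb := GClosure.fixedPowBaseChange_bijective hA R' G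
  exact ⟨hA.baseChange R', GClosure.tensorPowBaseChange_bijective R A n R', hb,
    hφ.baseChange hb (GClosure.fixedPowBaseChange_bijective hA R' ⊤).surjective,
    GClosure.closureAlgebraBaseChange φ hb, GClosure.closureAlgebraBaseChange_tmul_mk φ hb⟩
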